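/- A signature $\sigma$ is a finite set of relation symbols with arities, and all $\sigma$-structures are finite. For $\sigma$-structures $\mathbf I,\mathbf S$ with domains $I,S$ and a positive integer $k$, write $\mathbf I\le_k\mathbf S$ if there is a non-empty family $\mathcal H$ of partial homomorphisms from $\mathbf I$ to $\mathbf S$ (homomorphisms $h$ to $\mathbf S$ from the substructure of $\mathbf I$ induced by a set $\operatorname{dom}(h)\subseteq I$) such that (1) every restriction of a member of $\mathcal H$ is in $\mathcal H$, and (2) for every $h\in\mathcal H$ with $|\operatorname{dom}(h)|<k$ and every $x\in I\setminus\operatorname{dom}(h)$ there is an $f\in\mathcal H$ extending $h$ with $\operatorname{dom}(f)=\operatorname{dom}(h)\cup\{x\}$. A PCSP template is a pair $(\mathbf S,\mathbf T)$ of $\sigma$-structures, with domains $S,T$, such that there is a homomorphism $\mathbf S\to\mathbf T$. It has width $k(n)$, where $k(n)$ is a function with positive integer values, if for every $n$ and every $\sigma$-structure $\mathbf I$ with $n$ elements, $\mathbf I\le_{k(n)}\mathbf S$ implies that there is a homomorphism $\mathbf I\to\mathbf T$. It has bounded width if it has width $k(n)$ for some $k(n)=O(1)$, and sublinear width if it has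 width $k(n)$ for some $k(n)=o(n)$. An $m$-ary polymorphism of $(\mathbf S,\mathbf T)$ is a map $f:S^m\to T$ that, for every $R\in\sigma$, sends any $m$ tuples of $R^{\mathbf S}$, coordinatewise, to a tuple of $R^{\mathbf T}$; $\operatorname{Pol}(\mathbf S,\mathbf T)$ is the set of all polymorphisms of $(\mathbf S,\mathbf T)$. **Corollary.** Let $(\mathbf S,\mathbf T)$ be a PCSP template of sublinear or bounded width. Then, for every integer $m\ge 3$, $\operatorname{Pol}(\mathbf S,\mathbf T)$ contains a weak near-unanimity polymorphism of arity $m$, that is, an $m$-ary polymorphism $f$ such that $$f(y,x,x,\dots,x)=f(x,y,x,\dots,x)=\cdots=f(x,\dots,x,x,y)\qquad\text{for all }x,y\in S.$$ -/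

import Mathlib

open FirstOrder Language Structure

/- Signatures are purely relational first-order languages with finitely many symbols; relational
structures, and homomorphisms `A →[L] B` between them, are those of Mathlib. -/

namespace PCSP

section Consistency

variable (L : Language) {I S : Type*} [L.Structure I] [L.Structure S]

/-- `h`, a map from a subset of `I` to `S`, is a partial homomorphism from `I` to `S`: it is a
homomorphism to `S` from the substructure of `I` induced by the domain of `h`. -/
def IsPartialHom (h : I →. S) : Prop :=
  ∀ ⦃r : ℕ⦄ (R : L.Relations r) (a : Fin r → I) (ha : ∀ i, a i ∈ h.Dom),
    RelMap R a → RelMap R fun i => h.fn (a i) (ha i)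

/-- `f` is an extension of `h`, i.e. `h ⊆ f`. -/
def IsExtension (h f : I →. S) : Prop :=
  ∀ a s, s ∈ h a → s ∈ f a

/-- `H` is a `k`-strategy on (the finite structure) `I` and `S`. -/
structure IsStrategy (k : ℕ) (H : Set (I →. S)) : Prop where
  nonempty : H.Nonempty
  isPartialHom : ∀ h ∈ H, IsPartialHom L h
  restrict_mem : ∀ h ∈ H, ∀ (X : Set I) (hX : X ⊆ h.Dom), h.restrict hX ∈ H
  extend : ∀ h ∈ H, h.Dom.ncard < k → ∀ x, x ∉ h.Dom →
    ∃ f ∈ H, IsExtension h f ∧ f.Dom = insert x h.Dom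

variable (I S) in
/-- `I ≤ₖ S`: there is a `k`-strategy on `I` and `S`. -/
def Consistent (k : ℕ) : Prop :=
  ∃ H : Set (I →. S), IsStrategy L k H

end Consistency

section Width

variable (L : Language) (S T : Type*) [L.Structure S] [L.Structure T]

/-- `(S, T)` has width `k(n)`: for every finite instance `I`, with `n` elements, if `I ≤_{k(n)} S`
then there is a homomorphism from `I` to `T`. -/
def HasWidth (k : ℕ → ℕ) : Prop :=
  ∀ (I : Type) [Finite I] [L.Structure I],
    Consistent L I S (k (Nat.card I)) → Nonempty (I →[L] T)

/-- `(S, T)` has width `k(n)` for some function `k` with positive integer values and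
`k(n) = O(1)`. -/
def HasBoundedWidth : Prop :=
  ∃ k : ℕ → ℕ, (∀ n, 0 < k n) ∧
    (fun n => (k n : ℝ)) =O[Filter.atTop] (fun _ => (1 : ℝ)) ∧ HasWidth L S T k

/-- `(S, T)` has width `k(n)` for some function `k` with positive integer values and
`k(n) = o(n)`. -/
def HasSublinearWidth : Prop :=
  ∃ k : ℕ → ℕ, (∀ n, 0 < k n) ∧
    (fun n => (k n : ℝ)) =o[Filter.atTop] (fun n => (n : ℝ)) ∧ HasWidth L S T k

/-- The set of `m`-ary polymorphisms of `(S, T)`: the maps `f : S ^ m → T` such that, for every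
relation symbol `R`, applying `f` coordinatewise to any `m` tuples `t 0, …, t (m - 1)` of the
interpretation of `R` in `S` gives a tuple of the interpretation of `R` in `T`. -/
def Pol (m : ℕ) : Set ((Fin m → S) → T) :=
  {f | ∀ ⦃r : ℕ⦄ (R : L.Relations r) (t : Fin m → Fin r → S),
    (∀ j, RelMap R (t j)) → RelMap R fun i => f fun j => t j i}

variable {S T}

/-- The weak near-unanimity identities
`f (y, x, …, x) = f (x, y, x, …, x) = ⋯ = f (x, …, x, y)`. -/
def IsWNU {m : ℕ} (f : (Fin m → S) → T) : Prop :=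
  ∀ (x y : S) (i j : Fin m),
    f (Function.update (fun _ => x) i y) = f (Function.update (fun _ => x) j y)

end Width

end PCSP

/-! Take an `m`-uniform hypergraph and introduce an unknown `m`-ary polymorphism for each edge.
Impose that the function obtained by putting `y` at position `i` and `x` elsewhere depends only on
the vertex at that position. This is an instance of size linear in the number `n` of vertices, if
the number of edges is linear. A homomorphism from it to `T` colours each vertex by a binary
function into `T`. If the hypergraph has no proper colouring with these boundedly many colours, some
edge is monochromatic, and its polymorphism is a weak near-unanimity (`exists_isWNU_of_hom`).

Conversely, selecting vertices so that each edge contains exactly one selected position turns each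
edge into a projection and solves the instance over `S`. This may fail globally but holds locally:
in a sparse random hypergraph, which is not colourable (`exists_isExpanding`), small edge sets are
almost disjoint. Hence a minimal obstruction to extending a selection from `D` has only O(|D|) edges
(`IsMinimalObstruction.card_le`). Selections that extend to all sets of at most `s` edges can
therefore be enlarged vertex by vertex (`IsGood.exists_insert`), which gives a strategy for `k`
linear in `n` (`consistent_of_isExpanding`). Sublinear width then forces the homomorphism to `T`. -/

namespace PCSP

/-! ### Extending one-per-edge selections in expanding hypergraphs. -/

section Hypergraph

variable {V E : Type*} {m : ℕ}

/-- The position `j` is the only one of the edge `e` whose vertex is selected by `α`. -/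
def SelectsOnly (ω : E → Fin m → V) (α : V → Bool) (e : E) (j : Fin m) : Prop :=
  ∀ i, α (ω e i) = true ↔ i = j

/-- The restriction of `β` to `D` extends to a selection of vertices that selects exactly one
position of each edge in `F`. -/
def Extends (ω : E → Fin m → V) (D : Finset V) (β : V → Bool) (F : Finset E) : Prop :=
  ∃ α : V → Bool, (∀ v ∈ D, α v = β v) ∧ ∀ e ∈ F, ∃ j, SelectsOnly ω α e j

/-- The vertex at position `i` of the edge `e` is not in `D` and occurs nowhere else in `F`. -/
def IsPrivate (ω : E → Fin m → V) (D : Finset V) (F : Finset E) (e : E) (i : Fin m) : Prop :=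
  ω e i ∉ D ∧ ∀ e' ∈ F, ∀ i', ω e' i' = ω e i → e' = e ∧ i' = i

/-- The set of vertices of the edges in `F`. -/
def cover [DecidableEq V] (ω : E → Fin m → V) (F : Finset E) : Finset V :=
  F.biUnion fun e => Finset.univ.image (ω e)

/-- The occurrences of the vertex `v` in the edges of `F`. -/
def occurrences [DecidableEq V] (ω : E → Fin m → V) (F : Finset E) (v : V) :
    Finset (E × Fin m) :=
  (F ×ˢ Finset.univ).filter fun x => ω x.1 x.2 = v

theorem mem_occurrences [DecidableEq V] {ω : E → Fin m → V} {F : Finset E} {v : V}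
    {x : E × Fin m} : x ∈ occurrences ω F v ↔ x.1 ∈ F ∧ ω x.1 x.2 = v := by
  simp [occurrences]

/-- Given a selection for `F \ G`, deselect `Z`, which meets no edge outside `G`. Each edge of `G`
then has at most one selected non-private position. If there is one, its private vertices are
deselected; if there is none, one private vertex is selected. Private vertices affect no other edge.
-/
theorem Extends.of_removable [DecidableEq E] {ω : E → Fin m → V} {D : Finset V} {β : V → Bool}
    {F G : Finset E} (hm : 0 < m) (Z : Set V)
    (hZD : ∀ v ∈ Z, v ∉ D) (hZ : ∀ e ∈ F, ∀ i, ω e i ∈ Z → e ∈ G)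
    (hpriv : ∀ e ∈ G, ∃ p, IsPrivate ω D F e p)
    (hatt : ∀ e ∈ G, ∀ i j, ¬ IsPrivate ω D F e i → ¬ IsPrivate ω D F e j →
      ω e i ∉ Z → ω e j ∉ Z → i = j)
    (hGF : G ⊆ F) (h : Extends ω D β (F \ G)) : Extends ω D β F := by
  classical
  obtain ⟨α, hαD, hα⟩ := h
  have : Nonempty (Fin m) := ⟨⟨0, hm⟩⟩
  choose! p hp using hpriv
  let α₀ : V → Bool := fun v => if v ∈ Z then false else α v
  -- A free edge has no selected position yet, so its private vertex at `p e` must be selected.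
  let free : E → Prop := fun e => ∀ j, ¬ IsPrivate ω D F e j → α₀ (ω e j) = false
  let α' : V → Bool := fun v =>
    if ∃ e ∈ G, ∃ i, IsPrivate ω D F e i ∧ ω e i = v then
      decide (∃ e ∈ G, ω e (p e) = v ∧ free e)
    else α₀ v
  have hD : ∀ v ∈ D, α' v = β v := by
    intro v hv
    have h1 : ¬ ∃ e ∈ G, ∃ i, IsPrivate ω D F e i ∧ ω e i = v := by
      rintro ⟨e, -, i, hi, rfl⟩
      exact hi.1 hv
    have h2 : v ∉ Z := fun h => hZD v h hv
    simp only [α', α₀, if_neg h1, if_neg h2, hαD v hv]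
  have hattached : ∀ e ∈ F, ∀ i, ¬ IsPrivate ω D F e i → α' (ω e i) = α₀ (ω e i) := by
    intro e he i hi
    have h1 : ¬ ∃ e' ∈ G, ∃ i', IsPrivate ω D F e' i' ∧ ω e' i' = ω e i := by
      rintro ⟨e', -, i', hi', h⟩
      obtain ⟨rfl, rfl⟩ := hi'.2 e he i h.symm
      exact hi hi'
    simp only [α', if_neg h1]
  have hprivate : ∀ e ∈ G, ∀ i, IsPrivate ω D F e i →
      (α' (ω e i) = true ↔ i = p e ∧ free e) := by
    intro e he i hi
    have h1 : ∃ e' ∈ G, ∃ i', IsPrivate ω D F e' i' ∧ ω e' i' = ω e i := ⟨e, he, i, hi, rfl⟩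
    simp only [α', if_pos h1, decide_eq_true_eq]
    constructor
    · rintro ⟨e', he', h, hf⟩
      obtain ⟨rfl, hp'⟩ := hi.2 e' (hGF he') _ h
      exact ⟨hp'.symm, hf⟩
    · rintro ⟨rfl, hf⟩
      exact ⟨e, he, rfl, hf⟩
  refine ⟨α', hD, fun e he => ?_⟩
  by_cases heG : e ∈ G
  · by_cases hf : free e
    · refine ⟨p e, fun i => ?_⟩
      by_cases hi : IsPrivate ω D F e i
      · rw [hprivate e heG i hi]
        exact and_iff_left hf
      · rw [hattached e he i hi, hf i hi]
        simp only [Bool.false_eq_true, false_iff]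
        rintro rfl
        exact hi (hp e heG)
    · have hf' := hf
      simp only [free, not_forall, Bool.not_eq_false] at hf'
      obtain ⟨j, hj, hjt⟩ := hf'
      have hnZ : ∀ i, α₀ (ω e i) = true → ω e i ∉ Z := by
        intro i hi hz
        simp [α₀, hz] at hi
      refine ⟨j, fun i => ?_⟩
      by_cases hi : IsPrivate ω D F e i
      · rw [hprivate e heG i hi]
        constructor
        · exact fun h => absurd h.2 hf
        · rintro rfl
          exact absurd hi hj
      · rw [hattached e he i hi]
        constructor
        · exact fun h => hatt e heG i j hi hj (hnZ i h) (hnZ j hjt)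
        · rintro rfl
          exact hjt
  · obtain ⟨j, hj⟩ := hα e (Finset.mem_sdiff.2 ⟨he, heG⟩)
    refine ⟨j, fun i => ?_⟩
    have h1 : ¬ ∃ e' ∈ G, ∃ i', IsPrivate ω D F e' i' ∧ ω e' i' = ω e i := by
      rintro ⟨e', he', i', hi', h⟩
      obtain ⟨rfl, rfl⟩ := hi'.2 e he i h.symm
      exact heG he'
    have h2 : ω e i ∉ Z := fun h => heG (hZ e he i h)
    simp only [α', α₀, if_neg h1, if_neg h2]
    exact hj i

/-- `F` is a minimal set of edges to which `β` on `D` does not extend. -/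
def IsMinimalObstruction (ω : E → Fin m → V) (D : Finset V) (β : V → Bool) (F : Finset E) :
    Prop :=
  ¬ Extends ω D β F ∧ ∀ F' ⊂ F, Extends ω D β F'

theorem exists_isMinimalObstruction {ω : E → Fin m → V} {D : Finset V} {β : V → Bool}
    {F : Finset E} (h : ¬ Extends ω D β F) : ∃ F' ⊆ F, IsMinimalObstruction ω D β F' := by
  induction F using Finset.strongInduction with
  | H F ih =>
    by_cases hF : ∀ F' ⊂ F, Extends ω D β F'
    · exact ⟨F, subset_rfl, h, hF⟩
    · push Not at hF
      obtain ⟨F', hF', hn⟩ := hF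
      obtain ⟨F'', h1, h2⟩ := ih F' hF' hn
      exact ⟨F'', h1.trans hF'.subset, h2⟩

theorem IsMinimalObstruction.not_removable {ω : E → Fin m → V} {D : Finset V}
    {β : V → Bool} {F : Finset E} (hm : 0 < m) (h : IsMinimalObstruction ω D β F) (G : Finset E) (Z : Set V)
    (hG : G.Nonempty) (hGF : G ⊆ F)
    (hZD : ∀ v ∈ Z, v ∉ D) (hZ : ∀ e ∈ F, ∀ i, ω e i ∈ Z → e ∈ G)
    (hpriv : ∀ e ∈ G, ∃ p, IsPrivate ω D F e p) :
    ∃ e ∈ G, ∃ i j, ¬ IsPrivate ω D F e i ∧ ¬ IsPrivate ω D F e j ∧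
      ω e i ∉ Z ∧ ω e j ∉ Z ∧ i ≠ j := by
  classical
  by_contra hcon
  push Not at hcon
  exact h.1 (Extends.of_removable hm Z hZD hZ hpriv hcon hGF
    (h.2 _ (Finset.sdiff_ssubset hGF hG)))

/-- An edge of `F` is thin if exactly two of its positions are not private, and the vertices at
these are not in `D` and have exactly two occurrences in `F`. -/
def IsThin [DecidableEq V] (ω : E → Fin m → V) (D : Finset V) (F : Finset E) (e : E) : Prop :=
  ∃ i j, i ≠ j ∧ (∀ l, ¬ IsPrivate ω D F e l ↔ l = i ∨ l = j) ∧
    ∀ l, ¬ IsPrivate ω D F e l → ω e l ∉ D ∧ (occurrences ω F (ω e l)).card = 2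

theorem exists_ne_ne (hm : 3 ≤ m) (i j : Fin m) : ∃ l, l ≠ i ∧ l ≠ j := by
  obtain ⟨l, hl⟩ : ∃ l, l ∉ ({i, j} : Finset (Fin m)) := by
    by_contra! hcon
    have h1 : (Finset.univ : Finset (Fin m)).card ≤ ({i, j} : Finset (Fin m)).card :=
      Finset.card_le_card fun x _ => hcon x
    have h2 := Finset.card_le_two (a := i) (b := j)
    simp only [Finset.card_univ, Fintype.card_fin] at h1
    omega
  exact ⟨l, by simpa using hl⟩

theorem IsThin.exists_isPrivate [DecidableEq V] {ω : E → Fin m → V} {D : Finset V}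
    {F : Finset E} {e : E} (hm : 3 ≤ m) (h : IsThin ω D F e) : ∃ p, IsPrivate ω D F e p := by
  obtain ⟨i, j, -, h, -⟩ := h
  obtain ⟨p, hp⟩ := exists_ne_ne hm i j
  refine ⟨p, ?_⟩
  by_contra hcon
  have := (h p).1 hcon
  tauto

/-- Otherwise the single edge `e` would be removable, with `Z` empty. -/
theorem IsMinimalObstruction.exists_two_not_isPrivate {ω : E → Fin m → V} {D : Finset V}
    {β : V → Bool} {F : Finset E} (hm : 3 ≤ m) (h : IsMinimalObstruction ω D β F) {e : E}
    (he : e ∈ F) : ∃ i j, ¬ IsPrivate ω D F e i ∧ ¬ IsPrivate ω D F e j ∧ i ≠ j := by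
  by_cases hp : ∃ p, IsPrivate ω D F e p
  · obtain ⟨e', he', i, j, h1, h2, -, -, h3⟩ := h.not_removable (by omega) {e} ∅ (by simp) (by simpa)
      (by simp) (by simp) (by simpa using hp)
    rw [Finset.mem_singleton] at he'
    subst he'
    exact ⟨i, j, h1, h2, h3⟩
  · push Not at hp
    exact ⟨⟨0, by omega⟩, ⟨1, by omega⟩, hp _, hp _, by simp⟩

/-- The other occurrence of a vertex that links a thin edge to the rest of a minimal obstruction
is in an edge that is not thin. -/
theorem IsMinimalObstruction.not_isThin_of_mem_occurrences [DecidableEq V]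
    {ω : E → Fin m → V} {D : Finset V}
    {β : V → Bool} {F : Finset E} (hm : 3 ≤ m) (h : IsMinimalObstruction ω D β F) {e : E}
    (he : e ∈ F) (hthin : IsThin ω D F e) {i : Fin m} (hi : ¬ IsPrivate ω D F e i)
    {x : E × Fin m} (hx : x ∈ occurrences ω F (ω e i)) (hxe : x ≠ (e, i)) :
    ¬ IsThin ω D F x.1 := by
  classical
  intro hthin'
  obtain ⟨e', i'⟩ := x
  obtain ⟨he', hxi⟩ := mem_occurrences.1 hx
  simp only at he' hxi hthin'
  have hi' : ¬ IsPrivate ω D F e' i' := fun hp => by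
    obtain ⟨rfl, rfl⟩ := hp.2 e he i hxi.symm
    exact hxe rfl
  obtain ⟨hD, hcard⟩ := (hthin.choose_spec.choose_spec.2.2 i hi)
  have hocc : occurrences ω F (ω e i) = {(e, i), (e', i')} := by
    symm
    apply Finset.eq_of_subset_of_card_le
    · intro y hy
      simp only [Finset.mem_insert, Finset.mem_singleton] at hy
      rcases hy with rfl | rfl
      · exact mem_occurrences.2 ⟨he, rfl⟩
      · exact hx
    · rw [hcard, Finset.card_pair hxe.symm]
  have key : ∀ e₀ ∈ ({e, e'} : Finset E), IsThin ω D F e₀ ∧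
      ∃ i₀, ¬ IsPrivate ω D F e₀ i₀ ∧ ω e₀ i₀ = ω e i := by
    intro e₀ h₀
    simp only [Finset.mem_insert, Finset.mem_singleton] at h₀
    rcases h₀ with rfl | rfl
    · exact ⟨hthin, i, hi, rfl⟩
    · exact ⟨hthin', i', hi', hxi⟩
  -- If both edges were thin, they could be removed together with `Z` their common vertex: outside
  -- `Z` each has at most one non-private position left.
  obtain ⟨e₀, he₀, a, b, ha, hb, haZ, hbZ, hab⟩ := h.not_removable (by omega) {e, e'} {ω e i} (by simp)
    (by
      intro y hy
      simp only [Finset.mem_insert, Finset.mem_singleton] at hy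
      rcases hy with rfl | rfl <;> assumption)
    (by simpa using hD)
    (by
      intro f hf l hl
      have : (f, l) ∈ occurrences ω F (ω e i) := mem_occurrences.2 ⟨hf, hl⟩
      rw [hocc] at this
      simp only [Finset.mem_insert, Finset.mem_singleton, Prod.mk.injEq] at this ⊢
      tauto)
    (fun e₀ h₀ => (key e₀ h₀).1.exists_isPrivate hm)
  obtain ⟨⟨c, d, hcd, hcd', -⟩, i₀, hi₀, h₀⟩ := key e₀ he₀
  rw [hcd'] at ha hb hi₀
  have h1 : a ≠ i₀ := by rintro rfl; exact haZ h₀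
  have h2 : b ≠ i₀ := by rintro rfl; exact hbZ h₀
  grind

/-- Send a thin edge to the other occurrence of one of its linking vertices. This lies in a non-thin
edge, and the map is injective because a linking vertex has only two occurrences. -/
theorem IsMinimalObstruction.card_isThin_le [DecidableEq V]
    {ω : E → Fin m → V} {D : Finset V}
    {β : V → Bool} {F : Finset E} (hm : 3 ≤ m) (h : IsMinimalObstruction ω D β F)
    [DecidablePred (IsThin ω D F)] :
    (F.filter (IsThin ω D F)).card ≤ m * (F.filter fun e => ¬ IsThin ω D F e).card := by
  classical
  have hex : ∀ e, e ∈ F → IsThin ω D F e → ∃ i, ∃ x : E × Fin m, ¬ IsPrivate ω D F e i ∧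
      x ∈ occurrences ω F (ω e i) ∧ x ≠ (e, i) := by
    rintro e he ⟨i, j, -, hij, hD⟩
    have hi : ¬ IsPrivate ω D F e i := (hij i).2 (Or.inl rfl)
    obtain ⟨x, hx, hne⟩ := Finset.exists_mem_ne (by rw [(hD i hi).2]; norm_num) (e, i)
    exact ⟨i, x, hi, hx, hne⟩
  have : Nonempty (Fin m) := ⟨⟨0, by omega⟩⟩
  rcases isEmpty_or_nonempty E with hE | hE
  · simp [Finset.eq_empty_of_isEmpty F]
  choose! pos other hpos hocc hne using hex
  have := Finset.card_le_card_of_injOn (s := F.filter (IsThin ω D F))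
    (t := (F.filter fun e => ¬ IsThin ω D F e) ×ˢ (Finset.univ : Finset (Fin m))) other
    (by
      intro e he
      simp only [Finset.coe_filter, Set.mem_ofPred_eq] at he
      have h1 := h.not_isThin_of_mem_occurrences hm he.1 he.2 (hpos e he.1 he.2)
        (hocc e he.1 he.2) (hne e he.1 he.2)
      have h2 := (mem_occurrences.1 (hocc e he.1 he.2)).1
      simp [h1, h2])
    (by
      intro e he e' he' hee
      simp only [Finset.coe_filter, Set.mem_ofPred_eq] at he he'
      have ho := hocc e he.1 he.2
      have ho' := hocc e' he'.1 he'.2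
      have hv : ω e (pos e) = ω e' (pos e') := by
        rw [← (mem_occurrences.1 ho).2, ← (mem_occurrences.1 ho').2, hee]
      have hcard := (he.2.choose_spec.choose_spec.2.2 _ (hpos e he.1 he.2)).2
      by_contra hne'
      have hsub : ({other e, (e, pos e), (e', pos e')} : Finset (E × Fin m)) ⊆
          occurrences ω F (ω e (pos e)) := by
        intro y hy
        simp only [Finset.mem_insert, Finset.mem_singleton] at hy
        rcases hy with rfl | rfl | rfl
        · exact ho
        · exact mem_occurrences.2 ⟨he.1, rfl⟩
        · exact mem_occurrences.2 ⟨he'.1, hv.symm⟩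
      have h3 := Finset.card_le_card hsub
      rw [Finset.card_eq_three.2 ⟨_, _, _, hne e he.1 he.2, hee ▸ hne e' he'.1 he'.2,
        fun h => hne' (Prod.mk.inj h).1, rfl⟩, hcard] at h3
      omega)
  rw [Finset.card_product, Finset.card_univ, Fintype.card_fin] at this
  linarith

/-! ### Discharging: counting the vertices of a minimal obstruction. -/

/-- The share of a vertex that each of its occurrences receives. -/
noncomputable def share [DecidableEq V] (ω : E → Fin m → V) (D : Finset V) (F : Finset E)
    (v : V) : ℚ :=
  if v ∈ D then 0 else 1 / (occurrences ω F v).card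

theorem card_cover_le_sum_share [DecidableEq V] (ω : E → Fin m → V) (D : Finset V)
    (F : Finset E) :
    ((cover ω F).card : ℚ) ≤ D.card + ∑ e ∈ F, ∑ i, share ω D F (ω e i) := by
  have h1 : ∑ e ∈ F, ∑ i, share ω D F (ω e i) =
      ∑ v ∈ cover ω F, ∑ x ∈ F ×ˢ (Finset.univ : Finset (Fin m)) with ω x.1 x.2 = v,
        share ω D F (ω x.1 x.2) := by
    rw [Finset.sum_fiberwise_of_maps_to, Finset.sum_product]
    intro x hx
    simp only [cover, Finset.mem_biUnion, Finset.mem_image]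
    exact ⟨x.1, (Finset.mem_product.1 hx).1, x.2, Finset.mem_univ _, rfl⟩
  have h2 : ∀ v ∈ cover ω F, (∑ x ∈ F ×ˢ (Finset.univ : Finset (Fin m)) with ω x.1 x.2 = v,
      share ω D F (ω x.1 x.2)) = if v ∈ D then 0 else 1 := by
    intro v hv
    have h3 : (∑ x ∈ F ×ˢ (Finset.univ : Finset (Fin m)) with ω x.1 x.2 = v,
        share ω D F (ω x.1 x.2)) = ∑ x ∈ occurrences ω F v, share ω D F v := by
      refine Finset.sum_congr rfl fun x hx => ?_
      rw [(Finset.mem_filter.1 hx).2]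
    rw [h3, Finset.sum_const, nsmul_eq_mul, share]
    split_ifs with hD
    · simp
    · have hpos : (occurrences ω F v).card ≠ 0 := by
        simp only [cover, Finset.mem_biUnion, Finset.mem_image] at hv
        obtain ⟨e, he, i, -, hi⟩ := hv
        exact Finset.card_ne_zero_of_mem (mem_occurrences.2 ⟨he, hi⟩ :
          (e, i) ∈ occurrences ω F v)
      field_simp
  have h4 : (∑ v ∈ cover ω F, if v ∈ D then (0 : ℚ) else 1) = (cover ω F \ D).card := by
    rw [Finset.card_eq_sum_ones, Nat.cast_sum, ← Finset.filter_notMem_eq_sdiff,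
      Finset.sum_filter]
    refine Finset.sum_congr rfl fun v _ => ?_
    by_cases hv : v ∈ D <;> simp [hv]
  rw [h1, Finset.sum_congr rfl h2, h4]
  have := Finset.card_le_card_sdiff_add_card (s := cover ω F) (t := D)
  have h5 : ((cover ω F).card : ℚ) ≤ (cover ω F \ D).card + D.card := by exact_mod_cast this
  linarith

theorem share_le_one [DecidableEq V] (ω : E → Fin m → V) (D : Finset V) (F : Finset E)
    (v : V) : share ω D F v ≤ 1 := by
  rw [share]
  split_ifs
  · norm_num
  · rw [one_div]
    exact Nat.cast_inv_le_one _

theorem two_le_card_occurrences [DecidableEq V] {ω : E → Fin m → V} {D : Finset V}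
    {F : Finset E} {e : E} (he : e ∈ F) {i : Fin m} (hi : ¬ IsPrivate ω D F e i)
    (hD : ω e i ∉ D) : 2 ≤ (occurrences ω F (ω e i)).card := by
  by_contra hcon
  apply hi
  refine ⟨hD, fun e' he' i' h => ?_⟩
  have := Finset.card_le_one.1 (by omega : (occurrences ω F (ω e i)).card ≤ 1) (e', i')
    (mem_occurrences.2 ⟨he', h⟩) (e, i) (mem_occurrences.2 ⟨he, rfl⟩)
  exact Prod.mk.inj this

theorem share_le_half [DecidableEq V] {ω : E → Fin m → V} {D : Finset V} {F : Finset E} {e : E}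
    (he : e ∈ F) {i : Fin m} (hi : ¬ IsPrivate ω D F e i) : share ω D F (ω e i) ≤ 1 / 2 := by
  rw [share]
  split_ifs with hD
  · norm_num
  · have : (2 : ℚ) ≤ (occurrences ω F (ω e i)).card := by
      exact_mod_cast two_le_card_occurrences he hi hD
    gcongr

theorem share_le_third [DecidableEq V] {ω : E → Fin m → V} {D : Finset V} {F : Finset E} {e : E}
    (he : e ∈ F) {i : Fin m} (hi : ¬ IsPrivate ω D F e i)
    (h2 : ¬ (ω e i ∉ D ∧ (occurrences ω F (ω e i)).card = 2)) :
    share ω D F (ω e i) ≤ 1 / 3 := by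
  rw [share]
  split_ifs with hD
  · norm_num
  · have h3 := two_le_card_occurrences he hi hD
    have : (3 : ℚ) ≤ (occurrences ω F (ω e i)).card := by
      have : 3 ≤ (occurrences ω F (ω e i)).card := by
        have : (occurrences ω F (ω e i)).card ≠ 2 := fun h => h2 ⟨hD, h⟩
        omega
      exact_mod_cast this
    gcongr

theorem sum_share_le [DecidableEq V] {ω : E → Fin m → V} {D : Finset V} {F : Finset E} {e : E}
    (s : Finset (Fin m)) :
    ∑ i, share ω D F (ω e i) ≤ m - s.card + ∑ i ∈ s, share ω D F (ω e i) := by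
  classical
  rw [← Finset.sum_sdiff (Finset.subset_univ s)]
  have h1 : ∑ i ∈ Finset.univ \ s, share ω D F (ω e i) ≤ ∑ i ∈ Finset.univ \ s, (1 : ℚ) :=
    Finset.sum_le_sum fun i _ => share_le_one _ _ _ _
  have h2 : (Finset.univ \ s).card + s.card = m := by
    rw [Finset.card_sdiff_add_card_eq_card (Finset.subset_univ s), Finset.card_univ,
      Fintype.card_fin]
  have h3 : ((Finset.univ \ s).card : ℚ) + s.card = m := by exact_mod_cast h2
  rw [Finset.sum_const, nsmul_eq_mul, mul_one] at h1
  linarith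

/-- Two non-private positions have share at most 1/2 each, which already saves 1. A non-thin edge
has either a third such position, saving another 1/2, or a non-private position with share at most
1/3, saving another 1/6. -/
theorem IsMinimalObstruction.sum_share_le [DecidableEq V] {ω : E → Fin m → V} {D : Finset V}
    {β : V → Bool} {F : Finset E} (hm : 3 ≤ m) (h : IsMinimalObstruction ω D β F) {e : E}
    (he : e ∈ F) [Decidable (IsThin ω D F e)] :
    ∑ i, share ω D F (ω e i) ≤ m - 1 - if IsThin ω D F e then 0 else 1 / 6 := by
  classical
  obtain ⟨i, j, hi, hj, hij⟩ := h.exists_two_not_isPrivate hm he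
  have h1 := PCSP.sum_share_le (ω := ω) (D := D) (F := F) (e := e) {i, j}
  rw [Finset.card_pair hij, Finset.sum_pair hij] at h1
  have hi' := share_le_half he hi
  have hj' := share_le_half he hj
  push_cast at h1
  split_ifs with hthin
  · linarith
  by_cases hl : ∃ l, ¬ IsPrivate ω D F e l ∧ l ≠ i ∧ l ≠ j
  · obtain ⟨l, hl, hli, hlj⟩ := hl
    have h2 := PCSP.sum_share_le (ω := ω) (D := D) (F := F) (e := e) {l, i, j}
    have hl' := share_le_half he hl
    rw [Finset.sum_insert (by simp [hli, hlj]), Finset.card_insert_of_notMem (by simp [hli, hlj]),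
      Finset.card_pair hij, Finset.sum_pair hij] at h2
    push_cast at h2
    linarith
  · push Not at hl
    have h3 : ∃ l, ¬ IsPrivate ω D F e l ∧
        ¬ (ω e l ∉ D ∧ (occurrences ω F (ω e l)).card = 2) := by
      by_contra! hcon
      refine hthin ⟨i, j, hij, fun l => ⟨fun hl' => ?_, ?_⟩, hcon⟩
      · by_contra! hne
        exact hne.2 (hl l hl' hne.1)
      · rintro (rfl | rfl) <;> assumption
    obtain ⟨l, hl', hl3⟩ := h3
    have h4 := share_le_third he hl' hl3
    by_cases hli : l = i
    · subst hli
      linarith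
    · have := hl l hl' hli
      subst this
      linarith

/-- In an expanding hypergraph, a minimal obstruction is not much larger than `D`. -/
theorem IsMinimalObstruction.card_le [DecidableEq V] {ω : E → Fin m → V} {D : Finset V}
    {β : V → Bool} {F : Finset E} (hm : 3 ≤ m) (h : IsMinimalObstruction ω D β F)
    (hexp : ((12 * (m + 1) : ℕ) * (m - 1) - 1 : ℝ) * F.card ≤
      (12 * (m + 1) : ℕ) * (cover ω F).card) :
    F.card ≤ 12 * (m + 1) * D.card := by
  classical
  have hthin := h.card_isThin_le hm
  have hsplit := F.card_filter_add_card_filter_not (IsThin ω D F)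
  have hcover := card_cover_le_sum_share ω D F
  have hsum : ∑ e ∈ F, ∑ i, share ω D F (ω e i) ≤
      ∑ e ∈ F, ((m : ℚ) - 1 - if IsThin ω D F e then 0 else 1 / 6) :=
    Finset.sum_le_sum fun e he => h.sum_share_le hm he
  have hval : ∑ e ∈ F, ((m : ℚ) - 1 - if IsThin ω D F e then 0 else 1 / 6) =
      (m - 1) * F.card - (F.filter fun e => ¬ IsThin ω D F e).card / 6 := by
    rw [Finset.sum_sub_distrib, Finset.sum_const, nsmul_eq_mul, mul_comm]
    congr 1
    rw [Finset.card_eq_sum_ones, Nat.cast_sum, Finset.sum_filter, Finset.sum_div]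
    refine Finset.sum_congr rfl fun e _ => ?_
    split_ifs <;> norm_num
  rw [hval] at hsum
  set t := F.card
  set P := (F.filter (IsThin ω D F)).card
  set Q := (F.filter fun e => ¬ IsThin ω D F e).card
  have h1 : (t : ℚ) ≤ (m + 1) * Q := by
    have : t ≤ (m + 1) * Q := by linarith
    exact_mod_cast this
  have hexp' : (12 * (m + 1) * (m - 1) - 1 : ℚ) * t ≤ 12 * (m + 1) * (cover ω F).card := by
    have : (((12 * (m + 1) * (m - 1) - 1 : ℚ) * t : ℚ) : ℝ) ≤
        ((12 * (m + 1) * (cover ω F).card : ℚ) : ℝ) := by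
      push_cast at hexp ⊢
      exact hexp
    exact_mod_cast this
  have h2 : ((cover ω F).card : ℚ) ≤ D.card + ((m - 1) * t - Q / 6) := by linarith
  have h3 : (12 * (m + 1) : ℚ) * (cover ω F).card ≤
      12 * (m + 1) * (D.card + ((m - 1) * t - Q / 6)) := by gcongr
  -- Since `t ≤ (m + 1) * Q`, the term `Q / 6` times `12 * (m + 1)` is at least `2 * t`, while
  -- expansion concedes only `t`.
  have h4 : (t : ℚ) ≤ 12 * (m + 1) * D.card := by linarith
  exact_mod_cast h4

/-- `β` on `D` extends to every set of at most `s` edges. -/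
def IsGood (ω : E → Fin m → V) (s : ℕ) (D : Finset V) (β : V → Bool) : Prop :=
  ∀ F : Finset E, F.card ≤ s → Extends ω D β F

theorem IsGood.mono {ω : E → Fin m → V} {s : ℕ} {D D' : Finset V} {β : V → Bool}
    (h : IsGood ω s D β) (hD : D' ⊆ D) : IsGood ω s D' β := fun F hF => by
  obtain ⟨α, h1, h2⟩ := h F hF
  exact ⟨α, fun v hv => h1 v (hD hv), h2⟩

/-- Every set of at most `s` edges has almost `m - 1` vertices per edge. -/
def IsExpanding [DecidableEq V] (ω : E → Fin m → V) (s : ℕ) : Prop :=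
  ∀ F : Finset E, F.card ≤ s → ((12 * (m + 1) : ℕ) * (m - 1) - 1 : ℝ) * F.card ≤
      (12 * (m + 1) : ℕ) * (cover ω F).card

/-- A minimal obstruction inside the given one still has at most `s` edges, so expansion applies to
it and makes its size independent of `s`. -/
theorem IsExpanding.exists_small_obstruction [DecidableEq V] {ω : E → Fin m → V} {s : ℕ}
    (hm : 3 ≤ m) (hω : IsExpanding ω s) {D : Finset V} {β : V → Bool} (h : ¬ IsGood ω s D β) :
    ∃ F, ¬ Extends ω D β F ∧ F.card ≤ 12 * (m + 1) * D.card := by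
  simp only [IsGood, not_forall] at h
  obtain ⟨F, hF, hn⟩ := h
  obtain ⟨F', hsub, hmin⟩ := exists_isMinimalObstruction hn
  exact ⟨F', hmin.1, hmin.card_le hm (hω F' ((Finset.card_le_card hsub).trans hF))⟩

theorem IsExpanding.isGood_empty [DecidableEq V] {ω : E → Fin m → V} {s : ℕ}
    (hm : 3 ≤ m) (hω : IsExpanding ω s) (β : V → Bool) : IsGood ω s ∅ β := by
  by_contra h
  obtain ⟨F, hF, hcard⟩ := hω.exists_small_obstruction hm h
  simp only [Finset.card_empty, mul_zero, Nat.le_zero, Finset.card_eq_zero] at hcard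
  subst hcard
  exact hF ⟨β, by simp, by simp⟩

/-- If both values at `x` failed, each would have a small obstruction. The union of the two has at
most `s` edges, so `β` extends to it, and the value of that extension at `x` contradicts one of
them. -/
theorem IsGood.exists_insert [DecidableEq V] {ω : E → Fin m → V} {s : ℕ}
    (hm : 3 ≤ m) (hω : IsExpanding ω s) {D : Finset V} {β : V → Bool} (h : IsGood ω s D β)
    (hs : 2 * (12 * (m + 1) * (D.card + 1)) ≤ s) (x : V) :
    ∃ β', (∀ v ∈ D, β' v = β v) ∧ IsGood ω s (insert x D) β' := by
  classical
  by_contra! hcon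
  have hex : ∀ b : Bool, ∃ F : Finset E, (∀ α : V → Bool, (∀ v ∈ D, α v = β v) → α x = b →
      ¬ ∀ e ∈ F, ∃ j, SelectsOnly ω α e j) ∧ F.card ≤ 12 * (m + 1) * (D.card + 1) := by
    intro b
    by_cases hb : ∃ α : V → Bool, (∀ v ∈ D, α v = β v) ∧ α x = b
    · obtain ⟨α, hα, rfl⟩ := hb
      obtain ⟨F, hF, hcard⟩ := hω.exists_small_obstruction hm (hcon α hα)
      refine ⟨F, fun α' hα' hx hsol => hF ⟨α', fun v hv => ?_, hsol⟩, hcard.trans ?_⟩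
      · rcases Finset.mem_insert.1 hv with rfl | hv
        · exact hx
        · rw [hα' v hv, hα v hv]
      · gcongr
        exact Finset.card_insert_le _ _
    · push Not at hb
      -- When `x` is in `D`, the value opposite to `β x` is excluded without any edges.
      exact ⟨∅, fun α hα hx => absurd hx (hb α hα), by simp⟩
  choose F hF hcard using hex
  obtain ⟨α, hα, hsol⟩ := h (F true ∪ F false) ((Finset.card_union_le _ _).trans (by
    have := hcard true
    have := hcard false
    omega))
  refine hF (α x) α hα rfl fun e he => hsol e ?_
  rw [Finset.mem_union]
  cases hx : α x <;> rw [hx] at he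
  · exact Or.inr he
  · exact Or.inl he

theorem IsGood.exists_union [DecidableEq V] {ω : E → Fin m → V} {s : ℕ}
    (hm : 3 ≤ m) (hω : IsExpanding ω s) {D : Finset V} {β : V → Bool} (h : IsGood ω s D β)
    (X : Finset V) (hs : 2 * (12 * (m + 1) * (D.card + X.card)) ≤ s) :
    ∃ β', (∀ v ∈ D, β' v = β v) ∧ IsGood ω s (X ∪ D) β' := by
  induction X using Finset.induction_on with
  | empty => exact ⟨β, fun _ _ => rfl, by simpa using h⟩
  | insert x X hx ih =>
    rw [Finset.card_insert_of_notMem hx] at hs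
    obtain ⟨β₁, h1, hg⟩ := ih (le_trans (by gcongr; omega) hs)
    obtain ⟨β₂, h2, hg'⟩ := hg.exists_insert hm hω (le_trans (by
      have := Finset.card_union_le X D
      refine Nat.mul_le_mul_left 2 (Nat.mul_le_mul_left _ ?_)
      omega) hs) x
    refine ⟨β₂, fun v hv => ?_, by rwa [Finset.insert_union]⟩
    rw [h2 v (Finset.mem_union_right _ hv), h1 v hv]

end Hypergraph

end PCSP

namespace PCSP

/-! ### Existence of expanding, non-colourable hypergraphs by counting. -/

section Counting

open Finset

theorem choose_mul_pow_self_le {N t : ℕ} : (N.choose t : ℝ) * t ^ t ≤ N ^ t * Real.exp 1 ^ t := by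
  have h1 : (N.choose t : ℝ) ≤ N ^ t / t.factorial := Nat.choose_le_pow_div t N
  have h2 : (t : ℝ) ^ t / t.factorial ≤ Real.exp t :=
    Real.pow_div_factorial_le_exp t (by positivity) t
  calc (N.choose t : ℝ) * t ^ t ≤ N ^ t / t.factorial * t ^ t := by gcongr
    _ = N ^ t * (t ^ t / t.factorial) := by ring
    _ ≤ N ^ t * Real.exp t := by gcongr
    _ = N ^ t * Real.exp 1 ^ t := by rw [← Real.exp_nat_mul, mul_one]

/-- A union bound for the configurations of `t` edges on at most `s` vertices. -/
theorem choose_mul_choose_mul_pow_le {m c d t s n : ℕ} {x : ℝ} (hd : 0 < d) (hx : 0 < x)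
    (hx1 : x ≤ 1) (ht : (m * t : ℝ) ≤ x ^ d * n) (hs : d * s + d * t + t ≤ d * (m * t)) :
    ((c * n).choose t : ℝ) * n.choose s * s ^ (m * t) ≤
      (c * m * Real.exp 1 * Real.exp 1 ^ m * x) ^ t * n ^ (m * t) := by
  have h1 : s + t ≤ m * t := by
    refine Nat.le_of_mul_le_mul_left ?_ hd
    rw [mul_add]
    omega
  obtain ⟨K, hK⟩ := Nat.exists_eq_add_of_le h1
  have h2 : t ≤ d * K := by
    rw [hK, mul_add, mul_add] at hs
    omega
  have hsm : (s : ℝ) ≤ m * t := by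
    have : s ≤ m * t := by omega
    exact_mod_cast this
  -- Split the exponent as `s + t + K`: the first two factors cancel against the binomial
  -- coefficients, and the last one gains `x ^ t` because `t ≤ d * K`.
  have h3 : (s : ℝ) ^ (m * t) ≤ s ^ s * (m ^ t * t ^ t * (x ^ t * n ^ K)) := by
    rw [hK, pow_add, pow_add, mul_assoc]
    gcongr
    · rw [← mul_pow]
      gcongr
    · calc (s : ℝ) ^ K ≤ (x ^ d * n) ^ K := by
            gcongr
            exact hsm.trans ht
        _ = x ^ (d * K) * n ^ K := by rw [mul_pow, ← pow_mul]
        _ ≤ x ^ t * n ^ K := by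
            gcongr ?_ * _
            exact pow_le_pow_of_le_one hx.le hx1 h2
  have he : Real.exp 1 ^ s ≤ (Real.exp 1 ^ m) ^ t := by
    rw [← pow_mul]
    exact pow_le_pow_right₀ (Real.one_le_exp (by norm_num)) (by omega)
  calc ((c * n).choose t : ℝ) * n.choose s * s ^ (m * t)
      ≤ ((c * n).choose t : ℝ) * n.choose s * (s ^ s * (m ^ t * t ^ t * (x ^ t * n ^ K))) := by
        gcongr
    _ = (((c * n).choose t : ℝ) * t ^ t) * (n.choose s * s ^ s) * (m ^ t * x ^ t * n ^ K) := by
        ring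
    _ ≤ (((c * n : ℕ) : ℝ) ^ t * Real.exp 1 ^ t) * (n ^ s * Real.exp 1 ^ s) *
        (m ^ t * x ^ t * n ^ K) := by
        gcongr ?_ * ?_ * _
        · exact choose_mul_pow_self_le
        · exact choose_mul_pow_self_le
    _ ≤ (((c * n : ℕ) : ℝ) ^ t * Real.exp 1 ^ t) * (n ^ s * (Real.exp 1 ^ m) ^ t) *
        (m ^ t * x ^ t * n ^ K) := by
        gcongr
    _ = _ := by
        rw [hK, Nat.cast_mul]
        simp only [mul_pow, pow_add]
        ring

/-- The `m`-tuples of vertices that are not monochromatic. -/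
def polychromatic {C : Type*} [DecidableEq C] [Fintype C] {n : ℕ} (m : ℕ) (col : Fin n → C) :
    Finset (Fin m → Fin n) :=
  univ.filter fun f => ¬ ∃ q, ∀ i, col (f i) = q

/-- By pigeonhole some colour class has at least `n / |C|` vertices; all tuples inside it are
monochromatic. -/
theorem card_polychromatic_le {C : Type*} [DecidableEq C] [Fintype C] [Nonempty C] {n m : ℕ}
    (col : Fin n → C) :
    ((polychromatic m col).card : ℝ) ≤ n ^ m * (1 - (1 / Fintype.card C) ^ m) := by
  have hN : (0 : ℝ) < Fintype.card C := by exact_mod_cast Fintype.card_pos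
  obtain ⟨q, hq⟩ := Fintype.exists_le_card_fiber_of_nsmul_le_card (M := ℝ) col
    (b := n / Fintype.card C) (by
      rw [nsmul_eq_mul, Fintype.card_fin]
      field_simp
      rfl)
  have h1 : polychromatic m col ⊆
      univ \ Fintype.piFinset fun _ => univ.filter fun v => col v = q := by
    intro f hf
    simp only [polychromatic, mem_filter, mem_univ, true_and, not_exists] at hf
    simpa [Fintype.mem_piFinset] using hf q
  have h2 := card_le_card h1
  have h3 := card_sdiff_add_card_eq_card
    (subset_univ (Fintype.piFinset fun _ : Fin m => univ.filter fun v => col v = q))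
  rw [Fintype.card_piFinset_const, card_univ, Fintype.card_fun, Fintype.card_fin,
    Fintype.card_fin] at h3
  have h4 : ((n : ℝ) / Fintype.card C) ^ m ≤
      ((univ.filter fun v => col v = q).card : ℝ) ^ m := by
    gcongr
  have h5 : ((univ \ Fintype.piFinset fun _ : Fin m => univ.filter fun v => col v = q).card : ℝ) +
      ((univ.filter fun v => col v = q).card : ℝ) ^ m = n ^ m := by exact_mod_cast h3
  have h6 : ((polychromatic m col).card : ℝ) ≤
      (univ \ Fintype.piFinset fun _ : Fin m => univ.filter fun v => col v = q).card := by
    exact_mod_cast h2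
  have h7 : (n : ℝ) ^ m * (1 - (1 / Fintype.card C) ^ m) =
      n ^ m - ((n : ℝ) / Fintype.card C) ^ m := by
    rw [div_pow, div_pow]
    ring
  linarith

/-- The hypergraphs that have a proper colouring with colours in `C`. -/
def colorable (C : Type*) [DecidableEq C] [Fintype C] (m n M : ℕ) :
    Finset (Fin M → Fin m → Fin n) :=
  univ.biUnion fun col : Fin n → C => Fintype.piFinset fun _ => polychromatic m col

/-- Union bound over the `|C| ^ n` colourings; the hypothesis on `c` lets the `c * n` independent
edges outweigh their number. -/
theorem card_colorable_le {C : Type*} [DecidableEq C] [Fintype C] [Nonempty C] {m n c : ℕ}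
    (hn : 0 < n)
    (hc : Fintype.card C * (1 - (1 / Fintype.card C : ℝ) ^ m) ^ c ≤ 1 / 2) :
    ((colorable C m n (c * n)).card : ℝ) ≤ 1 / 2 * (n ^ m) ^ (c * n) := by
  have hN : (1 : ℝ) ≤ Fintype.card C := by exact_mod_cast Fintype.card_pos
  have hp : (0 : ℝ) ≤ 1 - (1 / Fintype.card C : ℝ) ^ m := by
    rw [sub_nonneg]
    exact pow_le_one₀ (by positivity) (by rw [div_le_one] <;> linarith)
  have h1 : ((colorable C m n (c * n)).card : ℝ) ≤
      ∑ col : Fin n → C, ((polychromatic m col).card : ℝ) ^ (c * n) := by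
    have := card_biUnion_le (s := (univ : Finset (Fin n → C)))
      (t := fun col => Fintype.piFinset fun _ : Fin (c * n) => polychromatic m col)
    simp only [Fintype.card_piFinset_const] at this
    exact_mod_cast this
  calc ((colorable C m n (c * n)).card : ℝ)
      ≤ ∑ col : Fin n → C, (n ^ m * (1 - (1 / Fintype.card C : ℝ) ^ m)) ^ (c * n) := by
        refine h1.trans (sum_le_sum fun col _ => ?_)
        gcongr
        exact card_polychromatic_le col
    _ = (Fintype.card C * (1 - (1 / Fintype.card C : ℝ) ^ m) ^ c) ^ n * (n ^ m) ^ (c * n) := by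
        rw [sum_const, card_univ, Fintype.card_fun, Fintype.card_fin, nsmul_eq_mul]
        push_cast
        simp only [mul_pow, ← pow_mul]
        ring
    _ ≤ (1 / 2) ^ n * (n ^ m) ^ (c * n) := by
        gcongr
    _ ≤ 1 / 2 * (n ^ m) ^ (c * n) := by
        gcongr
        exact pow_le_of_le_one (by norm_num) (by norm_num) hn.ne'

/-- The hypergraphs in which some `t` edges have all their vertices in a set of size `s`. -/
def concentrated (m n M t s : ℕ) : Finset (Fin M → Fin m → Fin n) :=
  (powersetCard t univ ×ˢ powersetCard s univ).biUnion fun X =>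
    Fintype.piFinset fun e => if e ∈ X.1 then Fintype.piFinset fun _ => X.2 else univ

theorem mem_concentrated {m n M s : ℕ} {ω : Fin M → Fin m → Fin n} {F : Finset (Fin M)}
    (h : (cover ω F).card ≤ s) (hs : s ≤ n) : ω ∈ concentrated m n M F.card s := by
  obtain ⟨W, hW, -, hcard⟩ := exists_subsuperset_card_eq (subset_univ (cover ω F)) h
    (by simpa using hs)
  simp only [concentrated, mem_biUnion, mem_product, mem_powersetCard_univ]
  refine ⟨(F, W), ⟨rfl, hcard⟩, ?_⟩
  rw [Fintype.mem_piFinset]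
  intro e
  split_ifs with he
  · rw [Fintype.mem_piFinset]
    exact fun i => hW (mem_biUnion.2 ⟨e, he, mem_image_of_mem _ (mem_univ i)⟩)
  · exact mem_univ _

/-- Union bound over the choice of edges and vertices. The factor `n ^ (m * t)` on the left replaces
a division. -/
theorem card_concentrated_le {m n M t s : ℕ} :
    (concentrated m n M t s).card * n ^ (m * t) ≤
      M.choose t * n.choose s * s ^ (m * t) * (n ^ m) ^ M := by
  have h1 : (concentrated m n M t s).card ≤
      ∑ _X ∈ powersetCard t (univ : Finset (Fin M)) ×ˢ powersetCard s (univ : Finset (Fin n)),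
        s ^ (m * t) * (n ^ m) ^ (M - t) := by
    refine card_biUnion_le.trans (sum_le_sum fun X hX => ?_)
    rw [mem_product, mem_powersetCard_univ, mem_powersetCard_univ] at hX
    rw [Fintype.card_piFinset]
    simp only [apply_ite Finset.card, Fintype.card_piFinset_const, card_univ, Fintype.card_fun,
      Fintype.card_fin]
    rw [prod_ite, prod_const, prod_const, filter_mem_eq_inter, univ_inter, hX.1, hX.2,
      filter_notMem_eq_sdiff, card_sdiff_of_subset (subset_univ _), hX.1, card_univ,
      Fintype.card_fin, pow_mul]
  rw [sum_const, card_product, card_powersetCard, card_powersetCard, card_univ, card_univ,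
    Fintype.card_fin, Fintype.card_fin, smul_eq_mul] at h1
  rcases le_or_gt t M with ht | ht
  · calc _ ≤ M.choose t * n.choose s * (s ^ (m * t) * (n ^ m) ^ (M - t)) * n ^ (m * t) := by
          gcongr
      _ = M.choose t * n.choose s * s ^ (m * t) * ((n ^ m) ^ (M - t) * (n ^ m) ^ t) := by
          rw [pow_mul n m t]
          ring
      _ = _ := by rw [← pow_add, Nat.sub_add_cancel ht]
  · rw [Nat.choose_eq_zero_of_lt ht] at h1 ⊢
    simp at h1
    simp [h1]

theorem sum_quarter_pow_lt (T : ℕ) : ∑ t ∈ Icc 1 T, (1 / 4 : ℝ) ^ t < 1 / 2 := by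
  have : ∑ t ∈ Icc 1 T, (1 / 4 : ℝ) ^ t = 1 / 3 * (1 - (1 / 4) ^ T) := by
    induction T with
    | zero => simp
    | succ T ih =>
      rw [sum_Icc_succ_top (by omega), ih]
      ring
  have h2 : (0 : ℝ) < (1 / 4) ^ T := by positivity
  rw [this]
  linarith

/-- There are hypergraphs with linearly many edges that have no proper colouring with colours in
`C`, but in which all sets of at most linearly many edges are nearly disjoint. -/
theorem exists_isExpanding (C : Type*) [Finite C] [Nonempty C] {m : ℕ} (hm : 2 ≤ m) :
    ∃ (c : ℕ) (ε : ℝ), 0 < ε ∧ ∀ n s : ℕ, 0 < n → (s : ℝ) ≤ ε * n →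
      ∃ ω : Fin (c * n) → Fin m → Fin n, IsExpanding ω s ∧
        ∀ col : Fin n → C, ∃ e q, ∀ i, col (ω e i) = q := by
  classical
  have := Fintype.ofFinite C
  have hN : (0 : ℝ) < Fintype.card C := by exact_mod_cast Fintype.card_pos
  obtain ⟨c, hc⟩ : ∃ c : ℕ, (1 - (1 / Fintype.card C : ℝ) ^ m) ^ c <
      1 / 2 / Fintype.card C :=
    exists_pow_lt_of_lt_one (by positivity) (by
      have : (0 : ℝ) < (1 / Fintype.card C : ℝ) ^ m := by positivity
      linarith)
  have hc' : Fintype.card C * (1 - (1 / Fintype.card C : ℝ) ^ m) ^ c ≤ 1 / 2 := by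
    rw [lt_div_iff₀ hN] at hc
    linarith
  obtain ⟨d, hd⟩ : ∃ d, d = 12 * (m + 1) := ⟨_, rfl⟩
  let A : ℝ := c * m * Real.exp 1 * Real.exp 1 ^ m
  have hA : 0 ≤ A := by positivity
  -- Chosen so that `A * x ≤ 1 / 4`, which makes the union bound for `t` edges a geometric term.
  let x : ℝ := 1 / (4 * (A + 1))
  have hx : 0 < x := by positivity
  have hx1 : x ≤ 1 := by
    rw [div_le_one (by positivity)]
    linarith
  have hAx : A * x ≤ 1 / 4 := by
    simp only [x]
    rw [mul_one_div, div_le_div_iff₀ (by positivity) (by norm_num)]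
    linarith
  have hm0 : (0 : ℝ) < m := by
    have : 0 < m := by omega
    exact_mod_cast this
  refine ⟨c, x ^ d / m, by positivity, fun n s hn hs => ?_⟩
  -- `a = d * (m - 1) - 1`, so a set of `t` edges violates expansion when it covers fewer than `a *
  -- t / d` vertices.
  obtain ⟨a, ha⟩ : ∃ a, d * m = a + 1 + d := by
    obtain ⟨m', rfl⟩ := Nat.exists_eq_add_of_le hm
    exact ⟨d * (m' + 1) - 1, by
      have : 0 < d * (m' + 1) := Nat.mul_pos (by omega) (by omega)
      have h2 : d * (2 + m') = d * (m' + 1) + d := by ring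
      omega⟩
  -- The bad hypergraphs: the colourable ones are at most 1/2 of all, the concentrated ones less
  -- than 1/2.
  let B : Finset (Fin (c * n) → Fin m → Fin n) :=
    colorable C m n (c * n) ∪
      (Icc 1 s).biUnion fun t => concentrated m n (c * n) t (a * t / d)
  have hn0 : (0 : ℝ) < n := by exact_mod_cast hn
  have hmt : ∀ t : ℕ, t ≤ s → (m * t : ℝ) ≤ x ^ d * n := by
    intro t ht
    have : (t : ℝ) ≤ s := by exact_mod_cast ht
    calc (m * t : ℝ) ≤ m * (x ^ d / m * n) := by
          gcongr
          exact this.trans hs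
      _ = x ^ d * n := by field_simp
  have hst : ∀ t : ℕ, d * (a * t / d) + d * t + t ≤ d * (m * t) := by
    intro t
    have h1 : d * (a * t / d) ≤ a * t := Nat.mul_div_le _ _
    have h2 : d * (m * t) = a * t + t + d * t := by rw [← mul_assoc, ha]; ring
    omega
  have hconc : ∀ t ∈ Icc 1 s, ((concentrated m n (c * n) t (a * t / d)).card : ℝ) ≤
      (1 / 4) ^ t * (n ^ m) ^ (c * n) := by
    intro t ht
    have h1 := card_concentrated_le (m := m) (n := n) (M := c * n) (t := t) (s := a * t / d)
    have h2 := choose_mul_choose_mul_pow_le (c := c) (by omega) hx hx1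
      (hmt t (mem_Icc.1 ht).2) (hst t)
    have h3 : ((concentrated m n (c * n) t (a * t / d)).card : ℝ) * n ^ (m * t) ≤
        (c * n).choose t * n.choose (a * t / d) * (a * t / d : ℕ) ^ (m * t) *
          (n ^ m) ^ (c * n) := by
      exact_mod_cast h1
    refine le_of_mul_le_mul_right (h3.trans ?_) (by positivity : (0 : ℝ) < (n : ℝ) ^ (m * t))
    calc _ ≤ (A * x) ^ t * n ^ (m * t) * (n ^ m) ^ (c * n) := by
          gcongr
      _ ≤ (1 / 4) ^ t * n ^ (m * t) * (n ^ m) ^ (c * n) := by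
          gcongr
      _ = _ := by ring
  have hpos : (0 : ℝ) < ((n : ℝ) ^ m) ^ (c * n) := by positivity
  have hB : (B.card : ℝ) < ((n : ℝ) ^ m) ^ (c * n) := by
    calc (B.card : ℝ) ≤ (colorable C m n (c * n)).card +
          ∑ t ∈ Icc 1 s, ((concentrated m n (c * n) t (a * t / d)).card : ℝ) := by
          have h1 := card_union_le (colorable C m n (c * n))
            ((Icc 1 s).biUnion fun t => concentrated m n (c * n) t (a * t / d))
          have h2 := card_biUnion_le (s := Icc 1 s)
            (t := fun t => concentrated m n (c * n) t (a * t / d))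
          exact_mod_cast h1.trans (Nat.add_le_add_left h2 _)
      _ ≤ 1 / 2 * (n ^ m) ^ (c * n) + ∑ t ∈ Icc 1 s, (1 / 4) ^ t * ((n : ℝ) ^ m) ^ (c * n) :=
          add_le_add (card_colorable_le hn hc') (sum_le_sum hconc)
      _ = (1 / 2 + ∑ t ∈ Icc 1 s, (1 / 4 : ℝ) ^ t) * (n ^ m) ^ (c * n) := by
          rw [← sum_mul, add_mul]
      _ < 1 * (n ^ m) ^ (c * n) := by
          gcongr
          linarith [sum_quarter_pow_lt s]
      _ = _ := one_mul _
  obtain ⟨ω, hω⟩ : ∃ ω, ω ∉ B := by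
    by_contra! hcon
    rw [eq_univ_iff_forall.2 hcon, card_univ, Fintype.card_fun, Fintype.card_fun] at hB
    simp at hB
  simp only [B, mem_union, not_or, mem_biUnion, not_exists, not_and] at hω
  refine ⟨ω, fun F hF => ?_, fun col => ?_⟩
  · by_contra! hcon
    rw [← hd] at hcon
    have ha' : ((d : ℕ) * (m - 1) - 1 : ℝ) = a := by
      have : (d * m : ℝ) = a + 1 + d := by exact_mod_cast ha
      linarith
    rw [ha'] at hcon
    have hcon' : d * (cover ω F).card < a * F.card := by exact_mod_cast hcon
    have hF1 : 1 ≤ F.card := by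
      by_contra h0
      have : F.card = 0 := by omega
      rw [this] at hcon'
      omega
    refine hω.2 F.card (mem_Icc.2 ⟨hF1, hF⟩) (mem_concentrated ?_ ?_)
    · rw [Nat.le_div_iff_mul_le (by omega), mul_comm]
      exact hcon'.le
    · have h1 := hmt F.card hF
      have h2 : x ^ d * n ≤ n := mul_le_of_le_one_left hn0.le (pow_le_one₀ hx.le hx1)
      have h3 : m * F.card ≤ n := by exact_mod_cast h1.trans h2
      have h4 := hst F.card
      have h5 : a * F.card / d ≤ m * F.card := by
        refine Nat.le_of_mul_le_mul_left ?_ (by omega : 0 < d)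
        omega
      exact h5.trans h3
  · by_contra hcon
    push Not at hcon
    refine hω.1 (mem_biUnion.2 ⟨col, mem_univ _, Fintype.mem_piFinset.2 fun e => ?_⟩)
    simpa [polychromatic] using hcon e

end Counting

end PCSP

namespace PCSP

/-! ### The instance of a hypergraph, its consistency and its homomorphisms. -/

section Instance

/-- The domain of the instance that a hypergraph defines: a vertex stands for the binary minors of
a polymorphism, an edge for an `m`-ary polymorphism. -/
abbrev Elem (V E A : Type) (m : ℕ) : Type :=
  A ⊕ (V × A × A) ⊕ (E × (Fin m → A))

variable {V E A : Type} {m : ℕ}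

open Classical in
/-- The element of the instance for the entry of the polymorphism of the edge `e` at `t`. Entries
at constant tuples are shared by all edges, and those at tuples `(x, …, y, …, x)` are shared by all
edges that have the same vertex at the position of `y`. -/
noncomputable def entry (ω : E → Fin m → V) (e : E) (t : Fin m → A) : Elem V E A m :=
  if h : ∃ x, t = fun _ => x then Sum.inl h.choose
  else if h : ∃ z : Fin m × A × A, t = Function.update (fun _ => z.2.1) z.1 z.2.2 then
    Sum.inr (Sum.inl (ω e h.choose.1, h.choose.2))
  else Sum.inr (Sum.inr (e, t))

/-- As `m ≥ 3`, some position avoids both `i` and `j` and reveals the majority value. -/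
theorem update_const_injective (hm : 3 ≤ m) {i j : Fin m} {x y x' y' : A} (hxy : x ≠ y)
    (h : Function.update (fun _ => x) i y = Function.update (fun _ => x') j y') :
    i = j ∧ x = x' ∧ y = y' := by
  have hx : x = x' := by
    obtain ⟨l, hl⟩ := exists_ne_ne hm i j
    simpa [Function.update_of_ne hl.1, Function.update_of_ne hl.2] using congrFun h l
  subst hx
  have hij : i = j := by
    by_contra hij
    have := congrFun h i
    rw [Function.update_self, Function.update_of_ne hij] at this
    exact hxy this.symm
  subst hij
  simpa using congrFun h i

theorem entry_update (hm : 3 ≤ m) (ω : E → Fin m → V) (e : E) (i : Fin m) {x y : A}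
    (hxy : x ≠ y) :
    entry ω e (Function.update (fun _ => x) i y) = Sum.inr (Sum.inl (ω e i, x, y)) := by
  have h1 : ¬ ∃ x', Function.update (fun _ => x) i y = fun _ => x' := by
    rintro ⟨x', h⟩
    have h2 : Function.update (fun _ => x) i y = Function.update (fun _ => x') i x' := by
      rw [h, Function.update_eq_self]
    obtain ⟨-, h3, h4⟩ := update_const_injective hm hxy h2
    exact hxy (h3.trans h4.symm)
  have h2 : ∃ z : Fin m × A × A,
      Function.update (fun _ => x) i y = Function.update (fun _ => z.2.1) z.1 z.2.2 :=
    ⟨(i, x, y), rfl⟩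
  obtain ⟨h3, h4, h5⟩ := update_const_injective hm hxy h2.choose_spec
  rw [entry, dif_neg h1, dif_pos h2, ← h3]
  congr 3
  exact Prod.ext h4.symm h5.symm

/-- The value of an element of the instance when each edge is the projection to the position that
`α` selects. -/
noncomputable def value [NeZero m] (ω : E → Fin m → V) (α : V → Bool) : Elem V E A m → A
  | Sum.inl x => x
  | Sum.inr (Sum.inl (v, x, y)) => if α v = true then y else x
  | Sum.inr (Sum.inr (e, t)) => t (Classical.epsilon (SelectsOnly ω α e))

/-- Sharing of entries is compatible with projections: at `(x, …, y, …, x)` the projection to `j`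
returns `y` exactly when `y` stands at `j`, that is, when the vertex there is selected. -/
theorem value_entry [NeZero m] {ω : E → Fin m → V} {α : V → Bool} {e : E} {j : Fin m}
    (h : SelectsOnly ω α e j) (t : Fin m → A) : value ω α (entry ω e t) = t j := by
  rw [entry]
  split_ifs with h1 h2
  · rw [value]
    exact (congrFun h1.choose_spec j).symm
  · rw [value]
    conv_rhs => rw [h2.choose_spec]
    by_cases hj : h2.choose.1 = j
    · rw [if_pos ((h _).2 hj), ← hj, Function.update_self]
    · rw [if_neg fun h' => hj ((h _).1 h'), Function.update_of_ne (Ne.symm hj)]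
  · have h3 : ∃ j, SelectsOnly ω α e j := ⟨j, h⟩
    rw [value]
    congr 1
    exact (h _).1 ((Classical.epsilon_spec h3 _).2 rfl)

/-- The vertices that the value of an element of the instance depends on. -/
def support [DecidableEq V] (ω : E → Fin m → V) : Elem V E A m → Finset V
  | Sum.inl _ => ∅
  | Sum.inr (Sum.inl (v, _)) => {v}
  | Sum.inr (Sum.inr (e, _)) => Finset.univ.image (ω e)

theorem card_support_le [DecidableEq V] [NeZero m] (ω : E → Fin m → V) (z : Elem V E A m) :
    (support ω z).card ≤ m := by
  rcases z with x | ⟨v, x⟩ | ⟨e, t⟩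
  · simp [support]
  · simpa [support] using NeZero.one_le
  · exact Finset.card_image_le.trans (by simp)

theorem value_congr [DecidableEq V] [NeZero m] {ω : E → Fin m → V} {α β : V → Bool}
    (z : Elem V E A m) (h : ∀ v ∈ support ω z, α v = β v) : value ω α z = value ω β z := by
  rcases z with x | ⟨v, x⟩ | ⟨e, t⟩
  · rfl
  · simp [value, h v (by simp [support])]
  · have : SelectsOnly ω α e = SelectsOnly ω β e := by
      funext j
      simp only [SelectsOnly, eq_iff_iff]
      refine forall_congr' fun i => ?_
      rw [h _ (by simp [support])]
    simp only [value, this]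

variable (L : Language) [L.IsRelational] {S T : Type*} [L.Structure S] [L.Structure T]

/-- The relations of the instance make every edge an `m`-ary polymorphism. -/
noncomputable abbrev instanceStructure (ω : E → Fin m → V) (σ : A → S) :
    L.Structure (Elem V E A m) where
  funMap := fun f => isEmptyElim f
  RelMap := fun {r} R a => ∃ (e : E) (t : Fin m → Fin r → A),
    (∀ j, RelMap R fun i => σ (t j i)) ∧ ∀ i, a i = entry ω e fun j => t j i

/-- The vertices that the values of the elements of `X` depend on. -/
noncomputable def supports [Fintype V] [DecidableEq V] (ω : E → Fin m → V)
    (X : Set (Elem V E A m)) : Finset V :=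
  (Set.toFinite {v | ∃ z ∈ X, v ∈ support ω z}).toFinset

theorem mem_supports [Fintype V] [DecidableEq V] {ω : E → Fin m → V}
    {X : Set (Elem V E A m)} {v : V} : v ∈ supports ω X ↔ ∃ z ∈ X, v ∈ support ω z := by
  simp [supports]

theorem supports_mono [Fintype V] [DecidableEq V] {ω : E → Fin m → V}
    {X Y : Set (Elem V E A m)} (h : X ⊆ Y) : supports ω X ⊆ supports ω Y := fun v hv => by
  obtain ⟨z, hz, hv⟩ := mem_supports.1 hv
  exact mem_supports.2 ⟨z, h hz, hv⟩

theorem supports_insert [Fintype V] [DecidableEq V] {ω : E → Fin m → V}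
    {X : Set (Elem V E A m)} {z : Elem V E A m} :
    supports ω (insert z X) = support ω z ∪ supports ω X := by
  ext v
  simp [mem_supports]

theorem card_supports_le [Fintype V] [DecidableEq V] [NeZero m] {ω : E → Fin m → V}
    {X : Set (Elem V E A m)} (hX : X.Finite) : (supports ω X).card ≤ m * X.ncard := by
  induction X, hX using Set.Finite.induction_on with
  | empty => simp [supports]
  | @insert z X hz hX ih =>
    rw [supports_insert, Set.ncard_insert_of_notMem hz hX]
    have h1 := Finset.card_union_le (support ω z) (supports ω X)
    have h2 := card_support_le ω z
    linarith

theorem consistent_of_isExpanding [Finite V] [DecidableEq V] [Finite E] [Finite A]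
    (hm : 3 ≤ m) {ω : E → Fin m → V} {s k : ℕ} (hω : IsExpanding ω s) (hk : 0 < k)
    (hs : 24 * (m + 1) * m * k ≤ s) (σ : A → S) :
    letI := instanceStructure L ω σ
    Consistent L (Elem V E A m) S k := by
  classical
  let := instanceStructure L ω σ
  have := Fintype.ofFinite V
  have : NeZero m := ⟨by omega⟩
  have hs1 : 1 ≤ s := le_trans (Nat.succ_le_of_lt (by
    have : 0 < m := by omega
    positivity)) hs
  -- The strategy: partial maps given by selections that are good on the support of the domain.
  refine ⟨{h | h.Dom.ncard ≤ k ∧ ∃ β, IsGood ω s (supports ω h.Dom) β ∧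
    ∀ z y, y ∈ h z → y = σ (value ω β z)}, ?_, ?_, ?_, ?_⟩
  · refine ⟨fun _ => Part.none, ?_, fun _ => false, ?_, ?_⟩
    · simp [PFun.Dom]
    · convert hω.isGood_empty hm _
      ext v
      simp [mem_supports, PFun.Dom]
    · simp
  · rintro h ⟨-, β, hβ, hval⟩ r R a ha ⟨e, t, ht, hat⟩
    -- A related tuple comes from a single edge, so extending the selection to that edge suffices;
    -- this needs `1 ≤ s`.
    obtain ⟨α, hα, hsel⟩ := hβ {e} (by simpa)
    obtain ⟨j, hj⟩ := hsel e (by simp)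
    have hfn : (fun i => h.fn (a i) (ha i)) = fun i => σ (t j i) := by
      funext i
      refine (hval (a i) _ (Part.get_mem (ha i))).trans ?_
      rw [← value_congr (α := α) (a i) fun v hv =>
        hα v (mem_supports.2 ⟨a i, ha i, hv⟩), hat i, value_entry hj]
    rw [hfn]
    exact ht j
  · rintro h ⟨hcard, β, hβ, hval⟩ X hX
    have hdom : (h.restrict hX).Dom = X := rfl
    refine ⟨?_, β, ?_, fun z y hy => hval z y ((PFun.mem_restrict hX z y).1 hy).2⟩
    · rw [hdom]
      exact (Set.ncard_le_ncard hX (Set.toFinite _)).trans hcard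
    · rw [hdom]
      exact hβ.mono (supports_mono hX)
  · rintro h ⟨-, β, hβ, hval⟩ hlt x hx
    -- At most `k` elements have at most `m * k` supporting vertices, whence the bound `2 * (12 * (m
    -- + 1) * (m * k)) ≤ s`.
    obtain ⟨β', hβ', hg⟩ := hβ.exists_union hm hω (support ω x) (by
      refine le_trans ?_ hs
      have h1 := card_supports_le (ω := ω) (Set.toFinite h.Dom)
      have h2 := card_support_le ω x
      have h3 : (supports ω h.Dom).card + (support ω x).card ≤ m * k := by
        calc _ ≤ m * h.Dom.ncard + m := by omega
          _ = m * (h.Dom.ncard + 1) := by ring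
          _ ≤ m * k := Nat.mul_le_mul_left m hlt
      calc _ ≤ 2 * (12 * (m + 1) * (m * k)) := by gcongr
        _ = _ := by ring)
    refine ⟨fun z => ⟨z ∈ insert x h.Dom, fun _ => σ (value ω β' z)⟩, ⟨?_, β', ?_, ?_⟩, ?_, rfl⟩
    · exact (Set.ncard_insert_le x h.Dom).trans hlt
    · convert hg
      exact supports_insert
    · rintro z y ⟨_, rfl⟩
      rfl
    · intro z y hy
      have hz : z ∈ h.Dom := Part.dom_iff_mem.2 ⟨y, hy⟩
      rw [hval z y hy, ← value_congr (α := β') z fun v hv =>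
        hβ' v (mem_supports.2 ⟨z, hz, hv⟩)]
      exact ⟨Or.inr hz, rfl⟩

/-- A homomorphism from the instance of a hypergraph with no proper colouring yields a weak
near-unanimity polymorphism. -/
theorem exists_isWNU_of_hom (hm : 3 ≤ m) {ω : E → Fin m → V} (σ : A ≃ S)
    (hω : ∀ col : V → A × A → T, ∃ e q, ∀ i, col (ω e i) = q)
    (g : letI := instanceStructure L ω σ; Elem V E A m →[L] T) :
    ∃ f ∈ Pol L S T m, IsWNU f := by
  let := instanceStructure L ω σ
  obtain ⟨e, q, hq⟩ := hω fun v z => g (Sum.inr (Sum.inl (v, z)))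
  refine ⟨fun u => g (entry ω e fun j => σ.symm (u j)), ?_, ?_⟩
  · intro r R t ht
    refine g.map_rel R (fun i => entry ω e fun j => σ.symm (t j i))
      ⟨e, fun j i => σ.symm (t j i), fun j => ?_, fun i => rfl⟩
    simpa using ht j
  · have key : ∀ (x y : S) (i : Fin m), x ≠ y →
        g (entry ω e fun j => σ.symm (Function.update (fun _ => x) i y j)) =
          q (σ.symm x, σ.symm y) := by
      intro x y i hxy
      have h1 : (fun j => σ.symm (Function.update (fun _ => x) i y j)) =
          Function.update (fun _ => σ.symm x) i (σ.symm y) := by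
        funext j
        by_cases hj : j = i
        · subst hj; simp
        · simp [Function.update_of_ne hj]
      rw [h1, entry_update hm ω e i (σ.symm.injective.ne hxy), ← hq i]
    intro x y i j
    by_cases hxy : x = y
    · subst hxy
      simp
    · exact (key x y i hxy).trans (key x y j hxy).symm

theorem HasSublinearWidth.exists_isWNU [Finite S] [Finite T] [Nonempty T]
    (h : HasSublinearWidth L S T) (hm : 3 ≤ m) : ∃ f ∈ Pol L S T m, IsWNU f := by
  obtain ⟨k, hk, hko, hwidth⟩ := h
  let a := Nat.card S
  -- Width is tested on instances in `Type`, so the instance is built over a copy of `S` there.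
  let σ : Fin a ≃ S := (Finite.equivFin S).symm
  obtain ⟨c, ε, hε, hex⟩ := exists_isExpanding (Fin a × Fin a → T) (m := m) (by omega)
  let size : ℕ → ℕ := fun n => a + n * (a * a) + c * n * a ^ m
  have hcard : ∀ n, Nat.card (Elem (Fin n) (Fin (c * n)) (Fin a) m) = size n := by
    intro n
    simp [size, Nat.card_eq_fintype_card, add_assoc]
  let B : ℝ := a + a * a + c * a ^ m
  have hsize : ∀ n, 0 < n → (size n : ℝ) ≤ B * n := by
    intro n hn
    have : (1 : ℝ) ≤ n := by exact_mod_cast hn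
    have h1 : (a : ℝ) ≤ a * n := le_mul_of_one_le_right (by positivity) this
    simp only [size, B]
    push_cast
    linarith
  let K : ℝ := 24 * (m + 1) * m
  have hm0 : (0 : ℝ) < m := by
    have : 0 < m := by omega
    exact_mod_cast this
  have hK : 0 < K := by positivity
  have hB : 0 ≤ B := by positivity
  -- With this `η` the linear part of the bound on `k` uses at most half of `ε * n`; the choice of
  -- `n` below leaves the other half for the constant `k₀`.
  let η : ℝ := ε / (2 * K * (B + 1))
  have hη : 0 < η := by positivity
  obtain ⟨N, hN⟩ := Filter.eventually_atTop.1 (hko.def hη)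
  -- For small instances the bound on `k` is a constant.
  obtain ⟨k₀, hk₀⟩ : ∃ k₀ : ℕ, ∀ j < N, k j ≤ k₀ :=
    ⟨∑ j ∈ Finset.range N, k j, fun j hj =>
      Finset.single_le_sum (f := k) (fun _ _ => Nat.zero_le _) (Finset.mem_range.2 hj)⟩
  have hkj : ∀ j, (k j : ℝ) ≤ η * j + k₀ := by
    intro j
    rcases lt_or_ge j N with hj | hj
    · have : (k j : ℝ) ≤ k₀ := by exact_mod_cast hk₀ j hj
      have h2 : 0 ≤ η * j := by positivity
      linarith
    · have := hN j hj
      simp only [Real.norm_natCast] at this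
      have h2 : (0 : ℝ) ≤ k₀ := by positivity
      linarith
  obtain ⟨n, hn⟩ := exists_nat_gt (2 * K * k₀ / ε)
  have hn0 : 0 < n := by
    have : (0 : ℝ) < n := lt_of_le_of_lt (by positivity) hn
    exact_mod_cast this
  let s : ℕ := 24 * (m + 1) * m * k (size n)
  have hs : (s : ℝ) ≤ ε * n := by
    have h1 : (s : ℝ) = K * k (size n) := by
      simp only [s, K]
      push_cast
      ring
    have h2 : (k (size n) : ℝ) ≤ η * (B * n) + k₀ :=
      (hkj _).trans (by gcongr; exact hsize n hn0)
    have h3 : K * (η * (B * n)) ≤ ε * n / 2 := by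
      have : K * (η * (B * n)) = (B / (B + 1)) * (ε * n / 2) := by
        simp only [η]
        field_simp
      rw [this]
      refine mul_le_of_le_one_left (by positivity) ?_
      rw [div_le_one (by positivity)]
      linarith
    have h4 : K * k₀ ≤ ε * n / 2 := by
      rw [div_lt_iff₀ hε] at hn
      linarith
    calc (s : ℝ) = K * k (size n) := h1
      _ ≤ K * (η * (B * n) + k₀) := by gcongr
      _ ≤ ε * n := by linarith
  obtain ⟨ω, hω, hcol⟩ := hex n s hn0 hs
  let := instanceStructure L ω σ
  have hcons := consistent_of_isExpanding L hm hω (hk (size n)) le_rfl σ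
  rw [← hcard] at hcons
  obtain ⟨g⟩ := hwidth (Elem (Fin n) (Fin (c * n)) (Fin a) m) hcons
  exact exists_isWNU_of_hom L hm σ hcol g

end Instance

theorem HasBoundedWidth.hasSublinearWidth (L : Language) {S T : Type*} [L.Structure S]
    [L.Structure T] (h : HasBoundedWidth L S T) :
    HasSublinearWidth L S T := by
  obtain ⟨k, hk, hkO, hwidth⟩ := h
  refine ⟨k, hk, hkO.trans_isLittleO ?_, hwidth⟩
  rw [Asymptotics.isLittleO_const_left]
  right
  simpa [Function.comp_def] using tendsto_natCast_atTop_atTop (R := ℝ)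

end PCSP

theorem corollary4p2 (L : FirstOrder.Language) [L.IsRelational] [Finite L.Symbols]
    (S T : Type*) [Finite S] [Finite T] [L.Structure S] [L.Structure T]
    (hST : Nonempty (S →[L] T))
    (hwidth : PCSP.HasSublinearWidth L S T ∨ PCSP.HasBoundedWidth L S T) :
    ∀ m : ℕ, 3 ≤ m → ∃ f ∈ PCSP.Pol L S T m, PCSP.IsWNU f := by
  intro m hm
  obtain ⟨g⟩ := hST
  have h : PCSP.HasSublinearWidth L S T :=
    hwidth.elim id fun h => PCSP.HasBoundedWidth.hasSublinearWidth L h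
  -- The set of colours must be non-empty. If `T` is empty, so is `S`, and the empty map is a
  -- polymorphism, with nullary relations transferred by `g`.
  rcases isEmpty_or_nonempty T with hT | hT
  · have : IsEmpty S := ⟨fun x => hT.false (g x)⟩
    have : IsEmpty (Fin m → S) := ⟨fun u => this.false (u ⟨0, by omega⟩)⟩
    refine ⟨fun u => isEmptyElim u, ?_, fun x => hT.elim (g x)⟩
    intro r R t ht
    convert g.map_rel R _ (ht ⟨0, by omega⟩) using 2
  · exact h.exists_isWNU L hm
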